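/- Throughout, a \emph{solution} of the Yang--Baxter equation is a pair $(X,r)$, where $X$ is a non-empty set (of arbitrary cardinality) and $r\colon X\times X\to X\times X$, $r(x,y)=(\lambda_x(y),\rho_y(x))$, is a bijective map such that all maps $\lambda_x,\rho_y\colon X\to X$ are bijective and $(r\times\mathrm{id})(\mathrm{id}\times r)(r\times\mathrm{id})=(\mathrm{id}\times r)(r\times\mathrm{id})(\mathrm{id}\times r)$ on $X^3$. The retract $\mathrm{Ret}(X,r)$ is the solution $(X/{\sim},\overline r)$, where $x\sim y$ if and only if $\lambda_x=\lambda_y$ and $\rho_x=\rho_y$, and $\overline r(\overline x,\overline y)=(\overline{\lambda_x(y)},\overline{\rho_y(x)})$. Put $(X_0,r_0)=(X,r)$ and $(X_{n},r_{n})=\mathrm{Ret}(X_{n-1},r_{n-1})$ for $n\ge 1$. For an integer $m\ge 0$, $(X,r)$ is a \emph{multipermutation solution of level $m$} if $|X_m|=1$ and, if $m>0$, $|X_{m-1}|>1$. Let $G(X,r)$ be the group generated by $X$ subject to the relations $x\circ y=\lambda_x(y)\circ\rho_y(x)$ for $x,y\in X$ (the structure group). Let $A(X,r)$ be the monoid,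 and $A_{\mathrm{gr}}(X,r)$ the group, generated by $X$ subject to the relations $x+\lambda_x(y)=\lambda_x(y)+\lambda_{\lambda_x(y)}(\rho_y(x))$ for $x,y\in X$ (the left derived structure monoid and group; the operation $+$ need not be commutative). A monoid $S$ is \emph{Malcev nilpotent of class $n$} if $n$ is the smallest non-negative integer such that $x_n(s,t;u_1,\dots,u_n)=y_n(s,t;u_1,\dots,u_n)$ for all $s,t,u_1,\dots,u_n\in S$, where the words $x_n=x_n(x,y;z_1,\dots,z_n)$ and $y_n=y_n(x,y;z_1,\dots,z_n)$ are defined by $x_0=x$, $y_0=y$, $x_{k+1}=x_kz_{k+1}y_k$ and $y_{k+1}=y_kz_{k+1}x_k$. \textbf{Theorem.} Let $(X,r)$ be a multipermutation solution of level $m$. Then the group $G(X,r)$ is solvable of derived length at most $m+1$. Moreover, the monoid $A(X,r)$ is Malcev nilpotent of class at most $m+3$, and the group $A_{\mathrm{gr}}(X,r)$ is nilpotent of class at most $m+1$. -/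

import Mathlib

universe u

/-- A solution of the Yang--Baxter equation on the set `X` is a map `r : X × X → X × X`, written
`r (x, y) = (lam x y, rho y x)`, on a non-empty set, such that `r` is bijective, all maps `lam x`
and `rho y` are bijective (non-degeneracy), and the braid relation
`(r × id) ∘ (id × r) ∘ (r × id) = (id × r) ∘ (r × id) ∘ (id × r)` holds on `X × X × X`. -/
structure YBESolution (X : Type u) where
  r : X × X → X × X
  nonempty : Nonempty X
  r_bijective : Function.Bijective r
  lam_bijective : ∀ x, Function.Bijective fun y => (r (x, y)).1
  rho_bijective : ∀ y, Function.Bijective fun x => (r (x, y)).2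
  braid :
    let r₁₂ : X × X × X → X × X × X := fun p =>
      ((r (p.1, p.2.1)).1, (r (p.1, p.2.1)).2, p.2.2)
    let r₂₃ : X × X × X → X × X × X := fun p => (p.1, r p.2)
    r₁₂ ∘ r₂₃ ∘ r₁₂ = r₂₃ ∘ r₁₂ ∘ r₂₃

namespace YBESolution

variable {X : Type u} (S : YBESolution X)

/-- The map `λ_x`, that is, `lam x y` is the first component of `r (x, y)`. -/
def lam (x y : X) : X := (S.r (x, y)).1

/-- The map `ρ_y`, that is, `rho y x` is the second component of `r (x, y)`. -/
def rho (y x : X) : X := (S.r (x, y)).2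

theorem lam_inj {x y z : X} (h : S.lam x y = S.lam x z) : y = z := (S.lam_bijective x).1 h

theorem rho_inj {x y z : X} (h : S.rho x y = S.rho x z) : y = z := (S.rho_bijective x).1 h

theorem lam_surj (x z : X) : ∃ y, S.lam x y = z := (S.lam_bijective x).2 z

theorem rho_surj (x z : X) : ∃ y, S.rho x y = z := (S.rho_bijective x).2 z

theorem lam_lam (x y z : X) :
    S.lam x (S.lam y z) = S.lam (S.lam x y) (S.lam (S.rho y x) z) :=
  (congrArg (fun p => p.1) (congrFun S.braid (x, y, z))).symm

theorem rho_rho (x y z : X) :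
    S.rho z (S.rho y x) = S.rho (S.rho z y) (S.rho (S.lam y z) x) :=
  congrArg (fun p => p.2.2) (congrFun S.braid (x, y, z))

/-- The solution `(X, r⁻¹)`. -/
noncomputable def symm : YBESolution X where
  r := (Equiv.ofBijective S.r S.r_bijective).symm
  nonempty := S.nonempty
  r_bijective := Equiv.bijective _
  lam_bijective a := by
    have key : ∀ z, S.r ((Equiv.ofBijective S.r S.r_bijective).symm (a, z)) = (a, z) :=
      fun z => (Equiv.ofBijective S.r S.r_bijective).apply_symm_apply (a, z)
    constructor
    · intro z z' h
      have h1 := key z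
      have h2 := key z'
      rcases hp : (Equiv.ofBijective S.r S.r_bijective).symm (a, z) with ⟨p, q⟩
      rcases hp' : (Equiv.ofBijective S.r S.r_bijective).symm (a, z') with ⟨p', q'⟩
      simp only [hp, hp'] at h h1 h2
      subst h
      have : q = q' := S.lam_inj (x := p) (by simp [lam, h1, h2])
      subst this
      simpa using h1.symm.trans h2
    · intro p
      obtain ⟨q, hq⟩ := S.lam_surj p a
      refine ⟨S.rho q p, ?_⟩
      have : (Equiv.ofBijective S.r S.r_bijective).symm (a, S.rho q p) = (p, q) := by
        rw [Equiv.symm_apply_eq, ← hq]; rfl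
      simp [this]
  rho_bijective a := by
    have key : ∀ z, S.r ((Equiv.ofBijective S.r S.r_bijective).symm (z, a)) = (z, a) :=
      fun z => (Equiv.ofBijective S.r S.r_bijective).apply_symm_apply (z, a)
    constructor
    · intro z z' h
      have h1 := key z
      have h2 := key z'
      rcases hp : (Equiv.ofBijective S.r S.r_bijective).symm (z, a) with ⟨q, p⟩
      rcases hp' : (Equiv.ofBijective S.r S.r_bijective).symm (z', a) with ⟨q', p'⟩
      simp only [hp, hp'] at h h1 h2
      subst h
      have : q = q' := S.rho_inj (x := p) (by simp [rho, h1, h2])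
      subst this
      simpa using h1.symm.trans h2
    · intro p
      obtain ⟨q, hq⟩ := S.rho_surj p a
      refine ⟨S.lam q p, ?_⟩
      have : (Equiv.ofBijective S.r S.r_bijective).symm (S.lam q p, a) = (q, p) := by
        rw [Equiv.symm_apply_eq, ← hq]; rfl
      simp [this]
  braid := by
    set e := Equiv.ofBijective S.r S.r_bijective with he
    have hes : ∀ p, S.r (e.symm p) = p := fun p => e.apply_symm_apply p
    have hse : ∀ p, e.symm (S.r p) = p := fun p => e.symm_apply_apply p
    intro s₁₂ s₂₃
    have hb := S.braid
    set r₁₂ : X × X × X → X × X × X := fun p =>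
      ((S.r (p.1, p.2.1)).1, (S.r (p.1, p.2.1)).2, p.2.2) with h12
    set r₂₃ : X × X × X → X × X × X := fun p => (p.1, S.r p.2) with h23
    have a1 : ∀ p, s₁₂ (r₁₂ p) = p := by intro p; simp [s₁₂, r₁₂, hse]
    have a2 : ∀ p, r₁₂ (s₁₂ p) = p := by intro p; simp [s₁₂, r₁₂, hes]
    have b1 : ∀ p, s₂₃ (r₂₃ p) = p := by intro p; simp [s₂₃, r₂₃, hse]
    have b2 : ∀ p, r₂₃ (s₂₃ p) = p := by intro p; simp [s₂₃, r₂₃, hes]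
    funext p
    have := congrFun hb (s₁₂ (s₂₃ (s₁₂ p)))
    simp only [Function.comp_apply] at this
    rw [a2, b2, a2] at this
    show s₁₂ (s₂₃ (s₁₂ p)) = s₂₃ (s₁₂ (s₂₃ p))
    conv_rhs => rw [this]
    rw [b1, a1, b1]

theorem symm_r_r (p : X × X) : S.symm.r (S.r p) = p :=
  (Equiv.ofBijective S.r S.r_bijective).symm_apply_apply p

theorem symm_lam (x y : X) : S.symm.lam (S.lam x y) (S.rho y x) = x :=
  congrArg Prod.fst ((Equiv.ofBijective S.r S.r_bijective).symm_apply_apply (x, y))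

theorem symm_rho (x y : X) : S.symm.rho (S.rho y x) (S.lam x y) = y :=
  congrArg Prod.snd ((Equiv.ofBijective S.r S.r_bijective).symm_apply_apply (x, y))

theorem lam_symm (x y : X) : S.lam (S.symm.lam x y) (S.symm.rho y x) = x :=
  congrArg Prod.fst ((Equiv.ofBijective S.r S.r_bijective).apply_symm_apply (x, y))

theorem rho_symm (x y : X) : S.rho (S.symm.rho y x) (S.symm.lam x y) = y :=
  congrArg Prod.snd ((Equiv.ofBijective S.r S.r_bijective).apply_symm_apply (x, y))

theorem symm_symm : S.symm.symm = S := by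
  have h : S.symm.symm.r = S.r := by
    funext p
    exact (Equiv.ofBijective S.symm.r S.symm.r_bijective).symm_apply_eq.2
      (S.symm_r_r p).symm
  generalize S.symm.symm = T at h
  cases S; cases T; cases h; rfl

/-- The solution `τ ∘ r ∘ τ`, where `τ` exchanges the two factors: the roles of `λ` and `ρ` are
interchanged. -/
def mirror : YBESolution X where
  r p := (S.r p.swap).swap
  nonempty := S.nonempty
  r_bijective := Prod.swap_bijective.comp (S.r_bijective.comp Prod.swap_bijective)
  lam_bijective := S.rho_bijective
  rho_bijective := S.lam_bijective
  braid := by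
    intro s₁₂ s₂₃
    funext p
    have h := congrFun S.braid (p.2.2, p.2.1, p.1)
    have h' := congrArg (fun q : X × X × X => (q.2.2, q.2.1, q.1)) h
    exact h'.symm

/-- The retract relation: `x ∼ y` if and only if `λ_x = λ_y` and `ρ_x = ρ_y`. -/
def retractSetoid : Setoid X where
  r x y := S.lam x = S.lam y ∧ S.rho x = S.rho y
  iseqv := ⟨fun _ => ⟨rfl, rfl⟩, fun h => ⟨h.1.symm, h.2.symm⟩,
    fun h h' => ⟨h.1.trans h'.1, h.2.trans h'.2⟩⟩

theorem lam_congr {x y : X} (h : S.retractSetoid x y) (z : X) :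
    S.retractSetoid (S.lam z x) (S.lam z y) := by
  obtain ⟨h1, h2⟩ := h
  constructor
  · funext w
    obtain ⟨w, rfl⟩ := S.lam_surj (S.rho x z) w
    rw [← S.lam_lam, h1, S.lam_lam, h2]
  · funext w
    have e1 := S.rho_rho w z x
    have e2 := S.rho_rho w z y
    rw [h2] at e1
    exact S.rho_inj (e1.symm.trans e2)

theorem rho_congr {x y : X} (h : S.retractSetoid x y) (z : X) :
    S.retractSetoid (S.rho z x) (S.rho z y) :=
  (S.mirror.lam_congr (x := x) (y := y) ⟨h.2, h.1⟩ z).symm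

/-- If `ρ_z w = z = ρ_{z'} w` then `z = z'`. -/
theorem diag_inj {w z z' : X} (h : S.rho z w = z) (h' : S.rho z' w = z') : z = z' := by
  have aux : ∀ z, S.rho z w = z → S.symm.lam w z = w := by
    intro z h
    set t := S.lam w z with ht
    have e : S.symm.lam t z = w := by
      have := S.symm_lam w z
      rwa [h] at this
    have e2 : S.symm.rho z t = z := by
      have := S.symm_rho w z
      rwa [h] at this
    obtain ⟨v, hv⟩ := S.symm.lam_surj z z
    have := S.symm.lam_lam t z v
    rw [e, e2, hv] at this
    rw [← this, e]
  exact S.symm.lam_inj ((aux z h).trans (aux z' h').symm)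

theorem symm_lam_eq {x y : X} (h : S.rho x = S.rho y) : S.symm.lam x = S.symm.lam y := by
  have aux : ∀ a, ∃ u, S.symm.lam x u = a ∧ S.symm.lam y u = a := by
    intro z
    obtain ⟨x', hx⟩ := S.lam_surj z x
    obtain ⟨y', hy⟩ := S.lam_surj z y
    obtain ⟨d, hd⟩ := S.rho_surj z z
    have h1 : S.rho (S.rho x' z) (S.rho x d) = S.rho x' z := by
      have := S.rho_rho d z x'
      rw [hd, hx] at this
      exact this.symm
    have h2 : S.rho (S.rho y' z) (S.rho x d) = S.rho y' z := by
      have := S.rho_rho d z y'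
      rw [hd, hy, ← h] at this
      exact this.symm
    have h3 := S.diag_inj h1 h2
    have e1 := S.symm_lam z x'
    have e2 := S.symm_lam z y'
    rw [hx] at e1
    rw [hy, ← h3] at e2
    exact ⟨_, e1, e2⟩
  funext u
  obtain ⟨u', h1, h2⟩ := aux (S.symm.lam x u)
  have := S.symm.lam_inj h1
  subst this
  exact h2.symm

theorem symm_rho_eq {x y : X} (h : S.lam x = S.lam y) : S.symm.rho x = S.symm.rho y := by
  have aux : ∀ x, S.mirror.symm.lam x = S.symm.rho x := by
    intro x
    funext u
    have e := S.mirror.symm_lam (S.symm.rho x u) (S.symm.lam u x)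
    have e1 : S.mirror.lam (S.symm.rho x u) (S.symm.lam u x) = x := S.rho_symm u x
    have e2 : S.mirror.rho (S.symm.lam u x) (S.symm.rho x u) = u := S.lam_symm u x
    rwa [e1, e2] at e
  rw [← aux, ← aux]
  exact S.mirror.symm_lam_eq h

theorem symm_rel {x y : X} (h : S.retractSetoid x y) : S.symm.retractSetoid x y :=
  ⟨S.symm_lam_eq h.2, S.symm_rho_eq h.1⟩

theorem rel_of_symm_rel {x y : X} (h : S.symm.retractSetoid x y) : S.retractSetoid x y := by
  have := S.symm.symm_rel h
  rwa [S.symm_symm] at this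

theorem rel_of_lam_rel {x y z : X} (h : S.retractSetoid (S.lam z x) (S.lam z y)) :
    S.retractSetoid x y := by
  have hh := S.symm_rel h
  have e1 := S.symm_lam z x
  have e2 := S.symm_lam z y
  rw [← hh.1] at e2
  have e3 : S.rho x z = S.rho y z := S.symm.lam_inj (e1.trans e2.symm)
  have := S.symm.rho_congr hh (S.rho x z)
  rw [S.symm_rho, e3, S.symm_rho] at this
  exact S.rel_of_symm_rel this

theorem rel_of_rho_rel {x y z : X} (h : S.retractSetoid (S.rho z x) (S.rho z y)) :
    S.retractSetoid x y :=
  (S.mirror.rel_of_lam_rel (x := x) (y := y) (z := z) ⟨h.2, h.1⟩).symm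

theorem lam_rel {x x' y y' : X} (hx : S.retractSetoid x x') (hy : S.retractSetoid y y') :
    S.retractSetoid (S.lam x y) (S.lam x' y') := by
  rw [← hx.1]; exact S.lam_congr hy x

theorem rho_rel {x x' y y' : X} (hx : S.retractSetoid x x') (hy : S.retractSetoid y y') :
    S.retractSetoid (S.rho y x) (S.rho y' x') := by
  rw [← hy.2]; exact S.rho_congr hx y

/-- The induced map on classes: `(x̄, ȳ) ↦ (class of λ_x(y), class of ρ_y(x))`. -/
def retractMap (p : Quotient S.retractSetoid × Quotient S.retractSetoid) :
    Quotient S.retractSetoid × Quotient S.retractSetoid :=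
  (Quotient.map₂ S.lam (fun _ _ h _ _ h' => S.lam_rel h h') p.1 p.2,
    Quotient.map₂ S.rho (fun _ _ h _ _ h' => S.rho_rel h' h) p.2 p.1)

/-- The retract `Ret(X, r)` of a solution: the solution induced on the set of classes of the
retract relation. -/
def retract : YBESolution (Quotient S.retractSetoid) where
  r := S.retractMap
  nonempty := S.nonempty.map (Quotient.mk _)
  r_bijective := by
    constructor
    · rintro ⟨⟨x⟩, ⟨y⟩⟩ ⟨⟨x'⟩, ⟨y'⟩⟩ h
      obtain ⟨h1, h2⟩ := Prod.ext_iff.1 h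
      have h1 := S.symm_rel (Quotient.exact h1)
      have h2 := S.symm_rel (Quotient.exact h2)
      have e1 := S.symm.lam_rel h1 h2
      have e2 := S.symm.rho_rel h1 h2
      rw [S.symm_lam, S.symm_lam] at e1
      rw [S.symm_rho, S.symm_rho] at e2
      exact Prod.ext (Quotient.sound (S.rel_of_symm_rel e1))
        (Quotient.sound (S.rel_of_symm_rel e2))
    · rintro ⟨⟨x⟩, ⟨y⟩⟩
      obtain ⟨⟨a, b⟩, h⟩ := S.r_bijective.2 (x, y)
      refine ⟨(Quotient.mk _ a, Quotient.mk _ b), ?_⟩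
      exact Prod.ext (congrArg (Quotient.mk _) (congrArg Prod.fst h))
        (congrArg (Quotient.mk _) (congrArg Prod.snd h))
  lam_bijective := by
    rintro ⟨z⟩
    constructor
    · rintro ⟨x⟩ ⟨y⟩ h
      exact Quotient.sound (S.rel_of_lam_rel (Quotient.exact h))
    · rintro ⟨x⟩
      obtain ⟨y, rfl⟩ := S.lam_surj z x
      exact ⟨Quotient.mk _ y, rfl⟩
  rho_bijective := by
    rintro ⟨z⟩
    constructor
    · rintro ⟨x⟩ ⟨y⟩ h
      exact Quotient.sound (S.rel_of_rho_rel (Quotient.exact h))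
    · rintro ⟨x⟩
      obtain ⟨y, rfl⟩ := S.rho_surj z x
      exact ⟨Quotient.mk _ y, rfl⟩
  braid := by
    intro s₁₂ s₂₃
    funext p
    obtain ⟨⟨x⟩, ⟨y⟩, ⟨z⟩⟩ := p
    exact congrArg (fun p : X × X × X => ((Quotient.mk S.retractSetoid p.1,
      Quotient.mk S.retractSetoid p.2.1, Quotient.mk S.retractSetoid p.2.2) :
        Quotient S.retractSetoid × Quotient S.retractSetoid × Quotient S.retractSetoid))
      (congrFun S.braid (x, y, z))

/-- The iterated retracts `Ret^n(X, r) = (X_n, r_n)`, with `(X_0, r_0) = (X, r)` and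
`(X_{n+1}, r_{n+1}) = Ret(X_n, r_n)`; each is given together with its underlying set. -/
def iterRetract : ℕ → Σ Y : Type u, YBESolution Y
  | 0 => ⟨X, S⟩
  | n + 1 => ⟨_, (iterRetract n).2.retract⟩

/-- `(X, r)` is a multipermutation solution of level `m`: `|X_m| = 1` and, if `m` is positive,
`|X_{m-1}| > 1`. -/
def IsMultipermutationOfLevel (m : ℕ) : Prop :=
  Nat.card (S.iterRetract m).1 = 1 ∧ (0 < m → Nontrivial (S.iterRetract (m - 1)).1)

/-- The relators `x ∘ y ∘ (λ_x(y) ∘ ρ_y(x))⁻¹` of the structure group. -/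
def structureGroupRels : Set (FreeGroup X) :=
  {w | ∃ x y : X, w = FreeGroup.of x * FreeGroup.of y *
    (FreeGroup.of (S.lam x y) * FreeGroup.of (S.rho y x))⁻¹}

/-- The structure group
`G(X, r) = gr(X ∣ x ∘ y = λ_x(y) ∘ ρ_y(x) for all x, y ∈ X)`. -/
abbrev StructureGroup : Type u := PresentedGroup S.structureGroupRels

/-- The defining relations `x + λ_x(y) = λ_x(y) + λ_{λ_x(y)}(ρ_y(x))` of the left derived
structure monoid (written multiplicatively). -/
inductive DerivedMonoidRels : FreeMonoid X → FreeMonoid X → Prop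
  | intro (x y : X) : DerivedMonoidRels
      (FreeMonoid.of x * FreeMonoid.of (S.lam x y))
      (FreeMonoid.of (S.lam x y) * FreeMonoid.of (S.lam (S.lam x y) (S.rho y x)))

/-- The left derived structure monoid `A(X, r)`, presented by the generators `X` and the relations
`x + λ_x(y) = λ_x(y) + λ_{λ_x(y)}(ρ_y(x))`. The operation, additive in the
usual notation although not commutative, is written multiplicatively. -/
abbrev DerivedMonoid : Type u := PresentedMonoid S.DerivedMonoidRels

/-- The relators of the left derived structure group (written multiplicatively). -/
def derivedGroupRels : Set (FreeGroup X) :=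
  {w | ∃ x y : X, w = FreeGroup.of x * FreeGroup.of (S.lam x y) *
    (FreeGroup.of (S.lam x y) * FreeGroup.of (S.lam (S.lam x y) (S.rho y x)))⁻¹}

/-- The left derived structure group `A_gr(X, r)`, the group with the same presentation as
`A(X, r)`, again written multiplicatively. -/
abbrev DerivedGroup : Type u := PresentedGroup S.derivedGroupRels

end YBESolution

/-- The values `(x_n, y_n)` of the Malcev words at `x = s`, `y = t`, `z_{i+1} = z i`:
`x_0 = s`, `y_0 = t`, `x_{n+1} = x_n z_{n+1} y_n`, `y_{n+1} = y_n z_{n+1} x_n`. -/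
def malcevWords {M : Type u} [Monoid M] (s t : M) (z : ℕ → M) : ℕ → M × M
  | 0 => (s, t)
  | n + 1 => ((malcevWords s t z n).1 * z n * (malcevWords s t z n).2,
      (malcevWords s t z n).2 * z n * (malcevWords s t z n).1)

/-- A monoid `M` is Malcev nilpotent of class `c` if `c` is the smallest `n` such that
`x_n(s, t; z_1, …, z_n) = y_n(s, t; z_1, …, z_n)` holds for all values in `M`
(for a monoid, `M¹ = M`). -/
def IsMalcevNilpotentOfClass (M : Type u) [Monoid M] (c : ℕ) : Prop :=
  IsLeast {n : ℕ | ∀ (s t : M) (z : ℕ → M), (malcevWords s t z n).1 = (malcevWords s t z n).2} c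

/-- A group is solvable of derived length `d` if `d` is the smallest `n` such that the `n`-th term
of the derived series (starting with `G` itself at `n = 0`) is trivial. -/
def IsSolvableOfDerivedLength (G : Type u) [Group G] (d : ℕ) : Prop :=
  IsLeast {n : ℕ | derivedSeries G n = ⊥} d

/-! ### Group-theoretic preliminaries -/

/-! Passing to the retract costs at most one step in each series, and on a one-point set both groups
are abelian; induction on the level then gives `m + 1`. In the structure group, conjugation by `z`
sends `y⁻¹x`, for `x ∼ y`, to `ρ_z(y)⁻¹ρ_z(x)` (`inv_mul_conj`). Since this depends on `z` only
through `ρ_z`, the elements `y⁻¹x` generate an abelian normal subgroup `K`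
(`structureGroupKer_comm`). In the derived group the relations read `x y = y σ_y(x)`, and `σ_y`
depends only on the class of `y`; so `x ∼ y` makes `y x⁻¹` central
(`derivedGroupOf_div_mem_center`). In both cases the group of the retract maps onto the quotient,
and surjectivity is all that is needed. In the derived monoid, `w a = a τ_a(w)` with an automorphism
`τ_a` that depends only on the image of `a` in the derived group (`derivedMonoid_mul_eq`). By
nilpotency of that group, the Malcev words `x_{m+1}` and `y_{m+1}` have equal images, hence the same
twist. For two elements with a common twist, two further Malcev steps give equality
(`malcev_step_of_twisted_commute`), whence `m + 3`. -/

/-- If `f : H →* G ⧸ N` is surjective and `N` is commutative, then the derived length of `G` exceeds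
that of `H` by at most one. -/
theorem derivedSeries_succ_eq_bot_of_surjective {G H : Type*} [Group G] [Group H]
    (N : Subgroup G) [N.Normal] (hN : ∀ a ∈ N, ∀ b ∈ N, a * b = b * a)
    (f : H →* G ⧸ N) (hf : Function.Surjective f) {n : ℕ} (h : derivedSeries H n = ⊥) :
    derivedSeries G (n + 1) = ⊥ := by
  have hQ : derivedSeries (G ⧸ N) n = ⊥ := by
    rw [← map_derivedSeries_eq hf, h, Subgroup.map_bot]
  have hle : derivedSeries G n ≤ N := by
    intro g hg
    have := map_derivedSeries_le_derivedSeries (QuotientGroup.mk' N) n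
      (Subgroup.mem_map_of_mem _ hg)
    rw [hQ, Subgroup.mem_bot] at this
    exact (QuotientGroup.eq_one_iff g).1 this
  rw [derivedSeries_succ, Subgroup.commutator_eq_bot_iff_le_centralizer]
  intro g hg
  rw [Subgroup.mem_centralizer_iff]
  exact fun k hk => hN k (hle hk) g (hle hg)

/-- If `f : H →* G ⧸ N` is surjective and `N` is central, then the nilpotency class of `G` exceeds
that of `H` by at most one. -/
theorem lowerCentralSeries_succ_eq_bot_of_surjective {G H : Type*} [Group G] [Group H]
    (N : Subgroup G) [N.Normal] (hN : N ≤ Subgroup.center G)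
    (f : H →* G ⧸ N) (hf : Function.Surjective f) {n : ℕ}
    (h : Subgroup.lowerCentralSeries (⊤ : Subgroup H) n = ⊥) :
    Subgroup.lowerCentralSeries (⊤ : Subgroup G) (n + 1) = ⊥ := by
  have hQ : Subgroup.lowerCentralSeries (⊤ : Subgroup (G ⧸ N)) n = ⊥ := by
    rw [← Subgroup.map_top_of_surjective f hf, ← Subgroup.map_lowerCentralSeries, h,
      Subgroup.map_bot]
  have hle : Subgroup.lowerCentralSeries (⊤ : Subgroup G) n ≤ Subgroup.center G := by
    refine le_trans (fun g hg => ?_) hN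
    have := Subgroup.mem_map_of_mem (QuotientGroup.mk' N) hg
    rw [Subgroup.map_lowerCentralSeries,
      Subgroup.map_top_of_surjective _ (QuotientGroup.mk'_surjective N), hQ,
      Subgroup.mem_bot] at this
    exact (QuotientGroup.eq_one_iff g).1 this
  rw [Subgroup.lowerCentralSeries_succ, Subgroup.commutator_eq_bot_iff_le_centralizer,
    Subgroup.coe_top, Subgroup.centralizer_univ]
  exact hle

theorem mul_comm_of_closure_eq_top {G : Type*} [Group G] {s : Set G}
    (hs : Subgroup.closure s = ⊤) (h : ∀ a ∈ s, ∀ b ∈ s, a * b = b * a) (a b : G) :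
    a * b = b * a := by
  have h1 : (⊤ : Subgroup G) ≤ Subgroup.centralizer s := by
    rw [← hs, Subgroup.closure_le]
    exact fun x hx => Subgroup.mem_centralizer_iff.2 fun y hy => h y hy x hx
  have h2 : (⊤ : Subgroup G) ≤ Subgroup.centralizer {a} := by
    rw [← hs, Subgroup.closure_le]
    intro x hx
    refine Subgroup.mem_centralizer_iff.2 ?_
    rintro _ rfl
    exact (Subgroup.mem_centralizer_iff.1 (h1 (Subgroup.mem_top _)) x hx).symm
  exact Subgroup.mem_centralizer_iff.1 (h2 (Subgroup.mem_top b)) a rfl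

/-! ### Malcev words and twisted commutation. -/

theorem malcevWords_map {M N : Type*} [Monoid M] [Monoid N] (f : M →* N) (s t : M) (z : ℕ → M)
    (n : ℕ) : malcevWords (f s) (f t) (fun i => f (z i)) n =
      (f (malcevWords s t z n).1, f (malcevWords s t z n).2) := by
  induction n with
  | zero => rfl
  | succ n ih => simp [malcevWords, ih]

/-- With `x = x_n`, `y = y_n`, one has `x z y (y z x)⁻¹ = [x y⁻¹, y z]`, so each Malcev step
descends one term in the series. -/
theorem malcevWords_div_mem_lowerCentralSeries {G : Type*} [Group G] (s t : G) (z : ℕ → G)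
    (n : ℕ) : (malcevWords s t z n).1 * (malcevWords s t z n).2⁻¹ ∈
      Subgroup.lowerCentralSeries (⊤ : Subgroup G) n := by
  induction n with
  | zero => simp
  | succ n ih =>
    have := Subgroup.commutator_mem_commutator ih
      (Subgroup.mem_top ((malcevWords s t z n).2 * z n))
    rw [Subgroup.lowerCentralSeries_succ]
    convert this using 1
    simp only [malcevWords, commutatorElement_def]
    group

theorem malcevWords_eq_of_lowerCentralSeries_eq_bot {G : Type*} [Group G] {n : ℕ}
    (h : Subgroup.lowerCentralSeries (⊤ : Subgroup G) n = ⊥) (s t : G) (z : ℕ → G) :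
    (malcevWords s t z n).1 = (malcevWords s t z n).2 := by
  have := malcevWords_div_mem_lowerCentralSeries s t z n
  rwa [h, Subgroup.mem_bot, mul_inv_eq_one] at this

/-- If `a` and `b` are normalised by the same surjective endomorphism `τ`, in the sense that
`w a = a τ(w)` and `w b = b τ(w)` for all `w`, then `a b b = b a b = b b a`. -/
theorem mul_mul_eq_of_twisted_commute {M : Type*} [Monoid M] {a b : M} {τ : M →* M}
    (hτ : Function.Surjective τ) (ha : ∀ w, w * a = a * τ w) (hb : ∀ w, w * b = b * τ w) :
    a * b * b = b * a * b ∧ b * b * a = b * a * b := by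
  have ha' : ∀ w, w * τ a = τ a * τ w := by
    intro w
    obtain ⟨w, rfl⟩ := hτ w
    rw [← map_mul, ha, map_mul]
  have hb' : ∀ w, w * τ b = τ b * τ w := by
    intro w
    obtain ⟨w, rfl⟩ := hτ w
    rw [← map_mul, hb, map_mul]
  -- All three products reduce to `b b τ(a)`. The point is `b b = b τ(b)`, which trades `b` for
  -- `τ(b)` behind another `b`.
  have e1 : b * a * b = b * b * τ a := by rw [mul_assoc, hb a, mul_assoc]
  have e2 : b * b * a = b * b * τ a := by
    rw [mul_assoc, ha b, hb' a, ← mul_assoc, ← hb b]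
  have e3 : b * b * τ a = b * b * τ (τ a) := by
    conv_lhs => rw [mul_assoc, ha' b, hb' (τ a), ← mul_assoc, ← hb b]
  refine ⟨?_, e2.trans e1.symm⟩
  rw [e1, e3, hb a, mul_assoc, hb (τ a), mul_assoc]

/-- Pushing `z`, `z'`, `z` to the right leaves the same tail on both sides, because all factors
passed have the twist `τ`. What remains is `a b b a = b a a b`. -/
theorem malcev_step_of_twisted_commute {M : Type*} [Monoid M] {a b : M} {τ : M →* M}
    (hτ : Function.Surjective τ) (ha : ∀ w, w * a = a * τ w) (hb : ∀ w, w * b = b * τ w)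
    (z z' : M) : (a * z * b) * z' * (b * z * a) = (b * z * a) * z' * (a * z * b) := by
  have h1 := mul_mul_eq_of_twisted_commute hτ ha hb
  have h2 := mul_mul_eq_of_twisted_commute hτ hb ha
  have h3 : a * b * b * a = b * a * a * b := by
    rw [h1.1, mul_assoc b a b, mul_assoc, ← h2.2, ← mul_assoc, ← mul_assoc]
  -- The first `z` passes `q`, `r`, `s`, then `z'` passes `r`, `s`, and the last `z` passes `s`:
  -- hence the powers 3, 2, 1 of `τ`.
  have key : ∀ p q r s : M, (∀ w, w * q = q * τ w) → (∀ w, w * r = r * τ w) →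
      (∀ w, w * s = s * τ w) →
      (p * z * q) * z' * (r * z * s) = p * q * r * s * (τ (τ (τ z)) * τ (τ z') * τ z) := by
    intro p q r s hq hr hs
    calc (p * z * q) * z' * (r * z * s)
        = p * (z * q) * z' * r * (z * s) := by simp only [mul_assoc]
      _ = p * q * (τ z * z' * r) * (s * τ z) := by rw [hq, hs]; simp only [mul_assoc]
      _ = p * q * r * (τ (τ z * z') * s) * τ z := by rw [hr]; simp only [mul_assoc]
      _ = _ := by rw [hs]; simp only [mul_assoc, map_mul]
  rw [key a b b a hb hb ha, key b a a b ha ha hb, h3]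

namespace YBESolution

variable {X : Type u} (S : YBESolution X)

/-! ### The derived rack -/

theorem lam_rho_middle (x y z : X) :
    S.lam (S.rho (S.lam y z) x) (S.rho z y) = S.rho (S.lam (S.rho y x) z) (S.lam x y) :=
  (congrArg (fun p => p.2.1) (congrFun S.braid (x, y, z))).symm

/-- The map `λ_x` as a permutation. -/
noncomputable def lamEquiv (x : X) : Equiv.Perm X := Equiv.ofBijective _ (S.lam_bijective x)

theorem lamEquiv_apply (x y : X) : S.lamEquiv x y = S.lam x y := rfl

/-- The maps `σ_y` of the left derived solution `(x, y) ↦ (y, σ_y(x))`, characterised by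
`σ_y(x) = λ_y(ρ_z(x))` for `y = λ_x(z)`. -/
noncomputable def sigma (y : X) : Equiv.Perm X := S.lamEquiv y * (S.symm.lamEquiv y)⁻¹

theorem sigma_lam (x z : X) : S.sigma (S.lam x z) x = S.lam (S.lam x z) (S.rho z x) := by
  have : (S.symm.lamEquiv (S.lam x z))⁻¹ x = S.rho z x := by
    rw [Equiv.Perm.inv_eq_iff_eq]
    exact (S.symm_lam x z).symm
  rw [sigma, Equiv.Perm.mul_apply, this, lamEquiv_apply]

theorem sigma_symm (y : X) : S.symm.sigma y = (S.sigma y)⁻¹ := by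
  rw [sigma, sigma, mul_inv_rev, inv_inv, S.symm_symm]

theorem sigma_eq_of_rel {x y : X} (h : S.retractSetoid x y) : S.sigma x = S.sigma y := by
  have h1 : S.lamEquiv x = S.lamEquiv y := Equiv.ext fun z => congrFun h.1 z
  have h2 : S.symm.lamEquiv x = S.symm.lamEquiv y :=
    Equiv.ext fun z => congrFun (S.symm_lam_eq h.2) z
  rw [sigma, sigma, h1, h2]

/-- With `y = λ_t(z)`, this is what the braid relation says once `σ` is expanded by `sigma_lam`. -/
theorem lam_sigma (x y t : X) : S.lam x (S.sigma y t) = S.sigma (S.lam x y) (S.lam x t) := by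
  obtain ⟨z, rfl⟩ := S.lam_surj t y
  rw [S.sigma_lam, S.lam_lam, S.lam_rho_middle, S.lam_lam x t z, S.sigma_lam]

theorem lamEquiv_mul_sigma (x y : X) :
    S.lamEquiv x * S.sigma y = S.sigma (S.lam x y) * S.lamEquiv x :=
  Equiv.ext fun t => S.lam_sigma x y t

/-- The inverse solution has the inverse maps `σ`, so its equivariance can be rewritten in terms of
the original `σ`. -/
theorem symm_lamEquiv_mul_sigma (x y : X) :
    S.symm.lamEquiv x * S.sigma y = S.sigma (S.symm.lam x y) * S.symm.lamEquiv x := by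
  have := S.symm.lamEquiv_mul_sigma x y
  rw [sigma_symm, sigma_symm, mul_inv_eq_iff_eq_mul, mul_assoc, eq_inv_mul_iff_mul_eq] at this
  exact this.symm

/-- Self-distributivity of the derived rack. -/
theorem sigma_mul_sigma (y z : X) :
    S.sigma z * S.sigma y = S.sigma (S.sigma z y) * S.sigma z := by
  -- Both factors in `σ_z = λ_z (λ'_z)⁻¹`, where `λ'` belongs to `r⁻¹`, are equivariant; `h1`
  -- handles the right factor and `h2` the left.
  have h1 := S.symm_lamEquiv_mul_sigma z ((S.symm.lamEquiv z)⁻¹ y)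
  rw [← lamEquiv_apply, ← Equiv.Perm.mul_apply, mul_inv_cancel, Equiv.Perm.one_apply] at h1
  have h2 := S.lamEquiv_mul_sigma z ((S.symm.lamEquiv z)⁻¹ y)
  have h3 : S.sigma z y = S.lam z ((S.symm.lamEquiv z)⁻¹ y) := rfl
  rw [h3]
  calc S.sigma z * S.sigma y
      = S.lamEquiv z * ((S.symm.lamEquiv z)⁻¹ * S.sigma y) := by rw [sigma, mul_assoc]
    _ = S.lamEquiv z * (S.sigma ((S.symm.lamEquiv z)⁻¹ y) * (S.symm.lamEquiv z)⁻¹) := by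
        rw [← mul_inv_eq_iff_eq_mul] at h1
        rw [← h1]; group
    _ = _ := by rw [← mul_assoc, h2, mul_assoc]; rfl

/-! ### The structure group -/

/-- The generator of the structure group given by `x`. -/
def structureGroupOf (x : X) : S.StructureGroup := PresentedGroup.of x

theorem structureGroupOf_mul (x y : X) : S.structureGroupOf x * S.structureGroupOf y =
    S.structureGroupOf (S.lam x y) * S.structureGroupOf (S.rho y x) := by
  have := PresentedGroup.one_of_mem (rels := S.structureGroupRels) ⟨x, y, rfl⟩
  rw [map_mul, map_inv, mul_inv_eq_one, map_mul, map_mul] at this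
  exact this

theorem closure_range_structureGroupOf :
    Subgroup.closure (Set.range S.structureGroupOf) = ⊤ :=
  PresentedGroup.closure_range_of _

/-- The elements `y⁻¹ x` of the structure group, for `x ∼ y`. -/
def structureGroupFibre : Set S.StructureGroup :=
  {g | ∃ x y : X, S.retractSetoid x y ∧ g = (S.structureGroupOf y)⁻¹ * S.structureGroupOf x}

/-- The subgroup of the structure group generated by all `y⁻¹ x` with `x ∼ y`; it is the kernel of
the projection to the structure group of the retract. -/
def structureGroupKer : Subgroup S.StructureGroup := Subgroup.closure S.structureGroupFibre

/-- The left side is `(y z)⁻¹(x z)`. As `λ_x = λ_y`, the rewritten products `x z` and `y z` share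
their first factor, which cancels. -/
theorem inv_mul_conj {x y : X} (h : S.retractSetoid x y) (z : X) :
    (S.structureGroupOf z)⁻¹ * ((S.structureGroupOf y)⁻¹ * S.structureGroupOf x) *
      S.structureGroupOf z =
    (S.structureGroupOf (S.rho z y))⁻¹ * S.structureGroupOf (S.rho z x) := by
  have h1 := S.structureGroupOf_mul x z
  have h2 := S.structureGroupOf_mul y z
  rw [← h.1] at h2
  calc _ = (S.structureGroupOf y * S.structureGroupOf z)⁻¹ *
        (S.structureGroupOf x * S.structureGroupOf z) := by group
    _ = _ := by rw [h1, h2]; group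

/-- The two directions are proved together so that the induction over words passes through inverses.
-/
theorem structureGroupFibre_conj (g : S.StructureGroup) :
    (∀ k ∈ S.structureGroupFibre, g * k * g⁻¹ ∈ S.structureGroupFibre) ∧
      ∀ k ∈ S.structureGroupFibre, g⁻¹ * k * g ∈ S.structureGroupFibre := by
  have hg : g ∈ Subgroup.closure (Set.range S.structureGroupOf) := by
    rw [closure_range_structureGroupOf]; exact Subgroup.mem_top g
  induction hg using Subgroup.closure_induction with
  | mem g hg =>
    obtain ⟨z, rfl⟩ := hg
    constructor
    · rintro _ ⟨x, y, h, rfl⟩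
      obtain ⟨x, rfl⟩ := S.rho_surj z x
      obtain ⟨y, rfl⟩ := S.rho_surj z y
      have h' := S.rel_of_rho_rel h
      refine ⟨x, y, h', ?_⟩
      rw [← S.inv_mul_conj h']
      group
    · rintro _ ⟨x, y, h, rfl⟩
      exact ⟨_, _, S.rho_congr h z, S.inv_mul_conj h z⟩
  | one => simp
  | mul a b _ _ iha ihb =>
    refine ⟨fun k hk => ?_, fun k hk => ?_⟩
    · have := iha.1 _ (ihb.1 k hk)
      convert this using 1; group
    · have := ihb.2 _ (iha.2 k hk)
      convert this using 1; group
  | inv a _ iha => exact ⟨by simpa using iha.2, by simpa using iha.1⟩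

instance structureGroupKer_normal : S.structureGroupKer.Normal := by
  refine ⟨fun k hk g => ?_⟩
  induction hk using Subgroup.closure_induction with
  | mem k hk => exact Subgroup.subset_closure ((S.structureGroupFibre_conj g).1 k hk)
  | one => simp [one_mem]
  | mul a b _ _ iha ihb =>
    have := mul_mem iha ihb
    convert this using 1; group
  | inv a _ iha =>
    have := inv_mem iha
    convert this using 1; group

/-- Conjugation by `u` and by `v` agree on the fibre elements when `ρ_u = ρ_v`, so `u v⁻¹`
centralises them. -/
theorem structureGroupFibre_comm :
    ∀ a ∈ S.structureGroupFibre, ∀ b ∈ S.structureGroupFibre, a * b = b * a := by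
  have aux : ∀ {u v : X}, S.retractSetoid u v → ∀ a ∈ S.structureGroupFibre,
      a * (S.structureGroupOf u * (S.structureGroupOf v)⁻¹) =
        (S.structureGroupOf u * (S.structureGroupOf v)⁻¹) * a := by
    rintro u v h _ ⟨x, y, hxy, rfl⟩
    have h1 := S.inv_mul_conj hxy u
    have h2 := S.inv_mul_conj hxy v
    rw [← h.2, ← h1] at h2
    generalize (S.structureGroupOf y)⁻¹ * S.structureGroupOf x = a at *
    generalize S.structureGroupOf u = u at *
    generalize S.structureGroupOf v = v at *
    calc a * (u * v⁻¹) = u * (u⁻¹ * a * u) * v⁻¹ := by group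
      _ = u * v⁻¹ * a := by rw [← h2]; group
  rintro a ha _ ⟨u, v, huv, rfl⟩
  -- Since `u v⁻¹` is the conjugate of `v⁻¹u` by `v`, the element `a` is conjugated by `v` as well.
  have h := aux huv _ ((S.structureGroupFibre_conj (S.structureGroupOf v)).1 a ha)
  generalize S.structureGroupOf u = u at *
  generalize S.structureGroupOf v = v at *
  calc a * (v⁻¹ * u) = v⁻¹ * (v * a * v⁻¹ * (u * v⁻¹)) * v := by group
    _ = v⁻¹ * u * a := by rw [h]; group

theorem structureGroupKer_comm :
    ∀ a ∈ S.structureGroupKer, ∀ b ∈ S.structureGroupKer, a * b = b * a := by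
  have h1 : S.structureGroupKer ≤ Subgroup.centralizer S.structureGroupFibre := by
    rw [structureGroupKer, Subgroup.closure_le]
    exact fun x hx =>
      Subgroup.mem_centralizer_iff.2 fun y hy => S.structureGroupFibre_comm y hy x hx
  intro a ha b hb
  have h2 : S.structureGroupKer ≤ Subgroup.centralizer {a} := by
    rw [structureGroupKer, Subgroup.closure_le]
    intro x hx
    refine Subgroup.mem_centralizer_iff.2 ?_
    rintro _ rfl
    exact (Subgroup.mem_centralizer_iff.1 (h1 ha) x hx).symm
  exact Subgroup.mem_centralizer_iff.1 (h2 hb) a rfl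

/-- The map from the generators of the structure group of the retract to the quotient of the
structure group by `structureGroupKer`. -/
def retractStructureMap (q : Quotient S.retractSetoid) : S.StructureGroup ⧸ S.structureGroupKer :=
  Quotient.lift (fun x => (QuotientGroup.mk (S.structureGroupOf x) :
      S.StructureGroup ⧸ S.structureGroupKer))
    (fun x y h => (QuotientGroup.eq.2
      (Subgroup.subset_closure ⟨x, y, h, rfl⟩ :
        (S.structureGroupOf y)⁻¹ * S.structureGroupOf x ∈ S.structureGroupKer)).symm) q

/-- The homomorphism from the structure group of the retract to the quotient of the structure group
by `structureGroupKer`. -/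
def retractStructureHom : S.retract.StructureGroup →* S.StructureGroup ⧸ S.structureGroupKer :=
  PresentedGroup.toGroup (f := S.retractStructureMap) <| by
    rintro _ ⟨⟨x⟩, ⟨y⟩, rfl⟩
    rw [map_mul, map_inv, mul_inv_eq_one, map_mul, map_mul]
    simp only [FreeGroup.lift_apply_of]
    exact congrArg (QuotientGroup.mk (s := S.structureGroupKer)) (S.structureGroupOf_mul x y)

theorem retractStructureHom_surjective : Function.Surjective S.retractStructureHom := by
  intro q
  obtain ⟨g, rfl⟩ := QuotientGroup.mk_surjective q
  have hg : g ∈ Subgroup.closure (Set.range S.structureGroupOf) := by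
    rw [closure_range_structureGroupOf]; exact Subgroup.mem_top g
  have hle : Subgroup.closure (Set.range S.structureGroupOf) ≤
      S.retractStructureHom.range.comap (QuotientGroup.mk' S.structureGroupKer) := by
    rw [Subgroup.closure_le]
    rintro _ ⟨x, rfl⟩
    exact ⟨PresentedGroup.of (Quotient.mk _ x), PresentedGroup.toGroup.of _⟩
  exact hle hg

theorem derivedSeries_structureGroup_of_retract {n : ℕ}
    (h : derivedSeries S.retract.StructureGroup n = ⊥) :
    derivedSeries S.StructureGroup (n + 1) = ⊥ :=
  derivedSeries_succ_eq_bot_of_surjective _ S.structureGroupKer_comm _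
    S.retractStructureHom_surjective h

theorem derivedSeries_structureGroup_of_subsingleton [Subsingleton X] :
    derivedSeries S.StructureGroup 1 = ⊥ := by
  have hc := mul_comm_of_closure_eq_top S.closure_range_structureGroupOf (by
    rintro _ ⟨x, rfl⟩ _ ⟨y, rfl⟩
    rw [Subsingleton.elim x y])
  rw [derivedSeries_succ, Subgroup.commutator_eq_bot_iff_le_centralizer]
  exact fun g _ => Subgroup.mem_centralizer_iff.2 fun k _ => hc k g

/-! ### The derived group -/

/-- The generator of the derived structure group given by `x`. -/
def derivedGroupOf (x : X) : S.DerivedGroup := PresentedGroup.of x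

theorem derivedGroupOf_mul (x y : X) : S.derivedGroupOf x * S.derivedGroupOf y =
    S.derivedGroupOf y * S.derivedGroupOf (S.sigma y x) := by
  obtain ⟨z, rfl⟩ := S.lam_surj x y
  have := PresentedGroup.one_of_mem (rels := S.derivedGroupRels) ⟨x, z, rfl⟩
  rw [map_mul, map_inv, mul_inv_eq_one, map_mul, map_mul, ← sigma_lam] at this
  exact this

theorem closure_range_derivedGroupOf :
    Subgroup.closure (Set.range S.derivedGroupOf) = ⊤ :=
  PresentedGroup.closure_range_of _

/-- Conjugating a generator `z` by `x` or by `y` gives `σ_x(z) = σ_y(z)`, so `y x⁻¹` commutes with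
all generators. -/
theorem derivedGroupOf_div_mem_center {x y : X} (h : S.retractSetoid x y) :
    S.derivedGroupOf y * (S.derivedGroupOf x)⁻¹ ∈ Subgroup.center S.DerivedGroup := by
  rw [← Subgroup.centralizer_univ, ← Subgroup.coe_top, ← S.closure_range_derivedGroupOf,
    Subgroup.centralizer_closure, Subgroup.mem_centralizer_iff]
  rintro _ ⟨z, rfl⟩
  have h1 := S.derivedGroupOf_mul z x
  have h2 := S.derivedGroupOf_mul z y
  rw [← S.sigma_eq_of_rel h] at h2
  calc S.derivedGroupOf z * (S.derivedGroupOf y * (S.derivedGroupOf x)⁻¹)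
      = S.derivedGroupOf y * S.derivedGroupOf (S.sigma x z) * (S.derivedGroupOf x)⁻¹ := by
        rw [← h2, mul_assoc]
    _ = S.derivedGroupOf y * (S.derivedGroupOf x)⁻¹ * (S.derivedGroupOf x *
          S.derivedGroupOf (S.sigma x z)) * (S.derivedGroupOf x)⁻¹ := by group
    _ = _ := by rw [← h1]; group

/-- The map from the generators of the derived group of the retract to the quotient of the derived
group by its centre. -/
def retractDerivedMap (q : Quotient S.retractSetoid) :
    S.DerivedGroup ⧸ Subgroup.center S.DerivedGroup :=
  Quotient.lift (fun x => (QuotientGroup.mk (S.derivedGroupOf x) :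
      S.DerivedGroup ⧸ Subgroup.center S.DerivedGroup))
    (fun _ _ h => QuotientGroup.eq.2
      (Subgroup.Normal.mem_comm inferInstance (S.derivedGroupOf_div_mem_center h))) q

/-- The homomorphism from the derived group of the retract to the quotient of the derived group by
its centre. -/
def retractDerivedHom :
    S.retract.DerivedGroup →* S.DerivedGroup ⧸ Subgroup.center S.DerivedGroup :=
  PresentedGroup.toGroup (f := S.retractDerivedMap) <| by
    rintro _ ⟨⟨x⟩, ⟨y⟩, rfl⟩
    rw [map_mul, map_inv, mul_inv_eq_one, map_mul, map_mul]
    simp only [FreeGroup.lift_apply_of]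
    have := S.derivedGroupOf_mul x (S.lam x y)
    rw [sigma_lam] at this
    exact congrArg (QuotientGroup.mk (s := Subgroup.center S.DerivedGroup)) this

theorem retractDerivedHom_surjective : Function.Surjective S.retractDerivedHom := by
  intro q
  obtain ⟨g, rfl⟩ := QuotientGroup.mk_surjective q
  have hg : g ∈ Subgroup.closure (Set.range S.derivedGroupOf) := by
    rw [closure_range_derivedGroupOf]; exact Subgroup.mem_top g
  have hle : Subgroup.closure (Set.range S.derivedGroupOf) ≤
      S.retractDerivedHom.range.comap (QuotientGroup.mk' (Subgroup.center S.DerivedGroup)) := by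
    rw [Subgroup.closure_le]
    rintro _ ⟨x, rfl⟩
    exact ⟨PresentedGroup.of (Quotient.mk _ x), PresentedGroup.toGroup.of _⟩
  exact hle hg

theorem lowerCentralSeries_derivedGroup_of_retract {n : ℕ}
    (h : Subgroup.lowerCentralSeries (⊤ : Subgroup S.retract.DerivedGroup) n = ⊥) :
    Subgroup.lowerCentralSeries (⊤ : Subgroup S.DerivedGroup) (n + 1) = ⊥ :=
  lowerCentralSeries_succ_eq_bot_of_surjective _ le_rfl _ S.retractDerivedHom_surjective h

theorem lowerCentralSeries_derivedGroup_of_subsingleton [Subsingleton X] :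
    Subgroup.lowerCentralSeries (⊤ : Subgroup S.DerivedGroup) 1 = ⊥ := by
  have hc := mul_comm_of_closure_eq_top S.closure_range_derivedGroupOf (by
    rintro _ ⟨x, rfl⟩ _ ⟨y, rfl⟩
    rw [Subsingleton.elim x y])
  rw [Subgroup.lowerCentralSeries_succ, Subgroup.commutator_eq_bot_iff_le_centralizer]
  exact fun g _ => Subgroup.mem_centralizer_iff.2 fun k _ => hc k g

/-! ### Induction on the multipermutation level -/

/-- The recursion retracts last; induction on the level has to retract first. -/
theorem iterRetract_succ (n : ℕ) : S.iterRetract (n + 1) = S.retract.iterRetract n := by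
  induction n with
  | zero => rfl
  | succ n ih =>
    exact congrArg (fun p : Σ Y : Type u, YBESolution Y =>
      (⟨_, p.2.retract⟩ : Σ Y : Type u, YBESolution Y)) ih

theorem series_eq_bot_of_subsingleton_iterRetract (m : ℕ) :
    ∀ {X : Type u} (S : YBESolution X), Subsingleton (S.iterRetract m).1 →
      derivedSeries S.StructureGroup (m + 1) = ⊥ ∧
      Subgroup.lowerCentralSeries (⊤ : Subgroup S.DerivedGroup) (m + 1) = ⊥ := by
  induction m with
  | zero =>
    intro X S h
    have : Subsingleton X := h
    exact ⟨S.derivedSeries_structureGroup_of_subsingleton,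
      S.lowerCentralSeries_derivedGroup_of_subsingleton⟩
  | succ m ih =>
    intro X S h
    rw [iterRetract_succ] at h
    exact ⟨S.derivedSeries_structureGroup_of_retract (ih S.retract h).1,
      S.lowerCentralSeries_derivedGroup_of_retract (ih S.retract h).2⟩

/-! ### The derived monoid -/

/-- The generator of the derived structure monoid given by `x`. -/
def derivedMonoidOf (x : X) : S.DerivedMonoid := PresentedMonoid.of _ x

theorem derivedMonoidOf_mul (x y : X) : S.derivedMonoidOf x * S.derivedMonoidOf y =
    S.derivedMonoidOf y * S.derivedMonoidOf (S.sigma y x) := by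
  obtain ⟨z, rfl⟩ := S.lam_surj x y
  have := PresentedMonoid.mk_eq_mk_of_rel (DerivedMonoidRels.intro (S := S) x z)
  rw [map_mul, map_mul, ← sigma_lam] at this
  exact this

/-- The homomorphism from the derived monoid induced by a map on generators that is compatible with
the derived rack. -/
def derivedMonoidLift {M : Type*} [Monoid M] (f : X → M)
    (hf : ∀ x y, f x * f y = f y * f (S.sigma y x)) : S.DerivedMonoid →* M :=
  PresentedMonoid.lift f <| by
    rintro _ _ ⟨x, y⟩
    rw [map_mul, map_mul]
    simp only [FreeMonoid.lift_eval_of]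
    rw [hf, sigma_lam]

theorem derivedMonoidLift_of {M : Type*} [Monoid M] (f : X → M)
    (hf : ∀ x y, f x * f y = f y * f (S.sigma y x)) (x : X) :
    S.derivedMonoidLift f hf (S.derivedMonoidOf x) = f x := rfl

theorem derivedMonoid_hom_ext {M : Type*} [Monoid M] {f g : S.DerivedMonoid →* M}
    (h : ∀ x, f (S.derivedMonoidOf x) = g (S.derivedMonoidOf x)) : f = g :=
  PresentedMonoid.ext _ h

/-- An automorphism of the derived rack. -/
def IsRackAut (e : Equiv.Perm X) : Prop := ∀ x y, e (S.sigma y x) = S.sigma (e y) (e x)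

theorem isRackAut_sigma (z : X) : S.IsRackAut (S.sigma z) :=
  fun x y => congrArg (fun e : Equiv.Perm X => e x) (S.sigma_mul_sigma y z)

theorem IsRackAut.inv {e : Equiv.Perm X} (h : S.IsRackAut e) : S.IsRackAut e⁻¹ := by
  intro x y
  have he : ∀ t, e (e⁻¹ t) = t := e.apply_symm_apply
  rw [Equiv.Perm.inv_eq_iff_eq, h, he, he]

/-- The endomorphism of the derived monoid induced by an automorphism of the derived rack. -/
def derivedMonoidMap (e : Equiv.Perm X) (h : S.IsRackAut e) : S.DerivedMonoid →* S.DerivedMonoid :=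
  S.derivedMonoidLift (fun x => S.derivedMonoidOf (e x)) fun x y => by
    rw [derivedMonoidOf_mul, h]

theorem derivedMonoidMap_of (e : Equiv.Perm X) (h : S.IsRackAut e) (x : X) :
    S.derivedMonoidMap e h (S.derivedMonoidOf x) = S.derivedMonoidOf (e x) := rfl

/-- The automorphism of the derived monoid induced by `σ_y`. -/
noncomputable def sigmaAut (y : X) : MulAut S.DerivedMonoid :=
  MonoidHom.toMulEquiv (S.derivedMonoidMap _ (S.isRackAut_sigma y))
    (S.derivedMonoidMap _ (S.isRackAut_sigma y).inv)
    (S.derivedMonoid_hom_ext fun x => by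
      simp [derivedMonoidMap_of])
    (S.derivedMonoid_hom_ext fun x => by
      simp [derivedMonoidMap_of])

theorem sigmaAut_of (x y : X) :
    S.sigmaAut y (S.derivedMonoidOf x) = S.derivedMonoidOf (S.sigma y x) := rfl

theorem sigmaAut_mul (y z : X) :
    S.sigmaAut z * S.sigmaAut y = S.sigmaAut (S.sigma z y) * S.sigmaAut z := by
  refine MulEquiv.toMonoidHom_injective (S.derivedMonoid_hom_ext fun x => ?_)
  exact congrArg S.derivedMonoidOf (S.isRackAut_sigma z x y)

/-- The action of the derived group on the derived monoid for which the generator `y` acts as the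
inverse of `σ_y`. -/
noncomputable def derivedAction : S.DerivedGroup →* MulAut S.DerivedMonoid :=
  PresentedGroup.toGroup (f := fun y => (S.sigmaAut y)⁻¹) <| by
    rintro _ ⟨x, y, rfl⟩
    rw [map_mul, map_inv, mul_inv_eq_one, map_mul, map_mul]
    simp only [FreeGroup.lift_apply_of]
    rw [← mul_inv_rev, ← mul_inv_rev, sigmaAut_mul, sigma_lam]

theorem derivedAction_of (y : X) : S.derivedAction (S.derivedGroupOf y) = (S.sigmaAut y)⁻¹ :=
  PresentedGroup.toGroup.of _

/-- The canonical homomorphism from the derived monoid to the derived group. -/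
def derivedMonoidToGroup : S.DerivedMonoid →* S.DerivedGroup :=
  S.derivedMonoidLift S.derivedGroupOf S.derivedGroupOf_mul

theorem closure_range_derivedMonoidOf :
    Submonoid.closure (Set.range S.derivedMonoidOf) = ⊤ :=
  PresentedMonoid.closure_range_of _

/-- On generators this is the defining relation. Moving `w` past `a b` applies the twist of `a`,
then that of `b`; this reverses products, hence the inverse of a homomorphism. -/
theorem derivedMonoid_mul_eq (w a : S.DerivedMonoid) :
    w * a = a * (S.derivedAction (S.derivedMonoidToGroup a))⁻¹ w := by
  have ha : a ∈ Submonoid.closure (Set.range S.derivedMonoidOf) := by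
    rw [closure_range_derivedMonoidOf]; exact Submonoid.mem_top a
  induction ha using Submonoid.closure_induction generalizing w with
  | mem a ha =>
    obtain ⟨y, rfl⟩ := ha
    rw [derivedMonoidToGroup, derivedMonoidLift_of, derivedAction_of, inv_inv]
    have hw : w ∈ Submonoid.closure (Set.range S.derivedMonoidOf) := by
      rw [closure_range_derivedMonoidOf]; exact Submonoid.mem_top w
    induction hw using Submonoid.closure_induction with
    | mem w hw =>
      obtain ⟨x, rfl⟩ := hw
      rw [derivedMonoidOf_mul, sigmaAut_of]
    | one => simp
    | mul u v _ _ ihu ihv => rw [mul_assoc, ihv, ← mul_assoc, ihu, mul_assoc, map_mul]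
  | one => simp
  | mul a b _ _ iha ihb =>
    rw [← mul_assoc, iha, mul_assoc, ihb, ← mul_assoc, map_mul, map_mul, mul_inv_rev]
    rfl

theorem malcevWords_derivedMonoid_eq {n : ℕ}
    (h : Subgroup.lowerCentralSeries (⊤ : Subgroup S.DerivedGroup) n = ⊥)
    (s t : S.DerivedMonoid) (z : ℕ → S.DerivedMonoid) :
    (malcevWords s t z (n + 2)).1 = (malcevWords s t z (n + 2)).2 := by
  have h1 := malcevWords_eq_of_lowerCentralSeries_eq_bot h (S.derivedMonoidToGroup s)
    (S.derivedMonoidToGroup t) fun i => S.derivedMonoidToGroup (z i)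
  rw [malcevWords_map] at h1
  dsimp only at h1
  have ha := fun w => S.derivedMonoid_mul_eq w (malcevWords s t z n).1
  have hb := fun w => S.derivedMonoid_mul_eq w (malcevWords s t z n).2
  -- Equal images in the group suffice for equal twists; the words themselves may still differ in
  -- the monoid.
  rw [← h1] at hb
  exact malcev_step_of_twisted_commute
    (τ := ((S.derivedAction (S.derivedMonoidToGroup (malcevWords s t z n).1))⁻¹ :
      MulAut S.DerivedMonoid).toMonoidHom) (MulEquiv.surjective _) ha hb _ _

end YBESolution

/-! ### The main theorem. -/

theorem mainTheorem3 {X : Type u} (S : YBESolution X) (m : ℕ)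
    (hm : S.IsMultipermutationOfLevel m) :
    (∃ d : ℕ, d ≤ m + 1 ∧ IsSolvableOfDerivedLength S.StructureGroup d) ∧
    (∃ _ : Group.IsNilpotent S.DerivedGroup, Group.nilpotencyClass S.DerivedGroup ≤ m + 1) ∧
    (∃ c : ℕ, c ≤ m + 3 ∧ IsMalcevNilpotentOfClass S.DerivedMonoid c) := by
  obtain ⟨h1, h2⟩ := YBESolution.series_eq_bot_of_subsingleton_iterRetract m S
    (Nat.card_eq_one_iff_unique.1 hm.1).1
  have h3 := S.malcevWords_derivedMonoid_eq h2
  have hn : Group.IsNilpotent S.DerivedGroup :=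
    Subgroup.nilpotent_iff_lowerCentralSeries.2 ⟨_, h2⟩
  -- Exact lengths and classes are least elements, so an index at which the property holds bounds
  -- them.
  have least : ∀ {P : ℕ → Prop} {n : ℕ}, P n → ∃ d ≤ n, IsLeast {k | P k} d := by
    classical
    intro P n h
    have h' : ∃ k, P k := ⟨n, h⟩
    exact ⟨Nat.find h', Nat.find_min' h' h, Nat.find_spec h', fun k hk => Nat.find_min' h' hk⟩
  exact ⟨least (P := fun n => derivedSeries S.StructureGroup n = ⊥) h1,
    ⟨hn, Subgroup.lowerCentralSeries_eq_bot_iff_nilpotencyClass_le.1 h2⟩,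
    least (P := fun n => ∀ (s t : S.DerivedMonoid) (z : ℕ → S.DerivedMonoid),
      (malcevWords s t z n).1 = (malcevWords s t z n).2) h3⟩
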